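/- Let $n \in \mathbb{N}$ and let $Q$ be a locally countable Borel quasi-order on $\mathbb{R}^n$; that is, $Q$ is a reflexive and transitive binary relation on $\mathbb{R}^n$ such that $\{(x,y) : x \mathrel{Q} y\}$ is a Borel subset of $\mathbb{R}^n \times \mathbb{R}^n$ and, for every $y \in \mathbb{R}^n$, the set $\{x \in \mathbb{R}^n : x \mathrel{Q} y\}$ is countable. Then there is a closed set $A \subseteq \mathbb{R}^n$ which is a $Q$-antichain (no two distinct points $x, y \in A$ satisfy $x \mathrel{Q} y$) and which has Hausdorff dimension $n$ with respect to the Euclidean metric. -/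

import Mathlib

open MeasureTheory Set Filter Topology

/-! Interleave the binary digits of each coordinate of `w ∈ [0,1)^n` with sparse bits of a real `z`.
For `n ≠ 0` this gives an injective Borel map `Ψ w z` into `ℝ^n` from which `w` is recovered Hölder
continuously with every exponent below 1. So for any `ζ`, the points `Ψ w (ζ w)`, with `w` in a set
of positive measure, have dimension `n`.

The freedom in `ζ` yields the antichain. Take `ζ w = u + v * θ w` with `θ` an injective Borel
function. Fix `w'` and the value `p = ζ w'`: the point `Ψ w' p` has countably many predecessors, and
each one, coming from some `w ≠ w'`, determines `v`. Hence by Fubini almost every `(v, u)` is good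
for `w'`, and some `(v, u)` is good for almost every `w'` (`exists_ae_forall_not_rel`). Inner
regularity then gives a compact antichain. -/

/-! ### Null analytic sets -/

theorem exists_le_forall_lt_measure_image {X : Type*} [MeasurableSpace X] (μ : Measure X)
    (f : (ℕ → ℕ) → X) {c : ENNReal} (hc : c < μ (range f)) :
    ∃ a : ℕ → ℕ, ∀ m, c < μ (f '' {x | ∀ i < m, x i ≤ a i}) := by
  have step : ∀ (m : ℕ) (T : Set (ℕ → ℕ)), c < μ (f '' T) →
      ∃ j : ℕ, c < μ (f '' {x ∈ T | x m ≤ j}) := by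
    intro m T hT
    have hU : f '' T = ⋃ j : ℕ, f '' {x ∈ T | x m ≤ j} := by
      rw [← image_iUnion]
      congr 1
      ext x
      simp only [mem_iUnion, mem_ofPred_eq]
      exact ⟨fun h => ⟨x m, h, le_rfl⟩, fun ⟨_, h, _⟩ => h⟩
    have hm : Monotone fun j : ℕ => f '' {x ∈ T | x m ≤ j} := fun j k hjk =>
      image_mono fun x hx => ⟨hx.1, hx.2.trans hjk⟩
    rw [hU, hm.measure_iUnion] at hT
    exact lt_iSup_iff.1 hT
  choose! j hj using step
  let T : ℕ → Set (ℕ → ℕ) := fun m => Nat.rec univ (fun m T => {x ∈ T | x m ≤ j m T}) m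
  have hT : ∀ m, c < μ (f '' T m) := by
    intro m
    induction m with
    | zero => simpa [T] using hc
    | succ m ih => exact hj m (T m) ih
  refine ⟨fun m => j m (T m), fun m => ?_⟩
  have : T m = {x | ∀ i < m, x i ≤ j i (T i)} := by
    induction m with
    | zero => simp [T]
    | succ m ih =>
      have : T (m + 1) = {x ∈ T m | x m ≤ j m (T m)} := rfl
      rw [this]
      nth_rewrite 1 [ih]
      ext x
      simp only [mem_ofPred_eq, Nat.forall_lt_succ_right]
  rw [← this]
  exact hT m

theorem isCompact_setOf_forall_le (a : ℕ → ℕ) : IsCompact {y : ℕ → ℕ | ∀ i, y i ≤ a i} := by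
  have := isCompact_univ_pi (X := fun _ : ℕ => ℕ) (s := fun i => Iic (a i))
    fun i => (finite_Iic (a i)).isCompact
  convert this using 1
  ext y
  simp [Pi.le_def]

theorem exists_subset_of_forall_le_subset {a : ℕ → ℕ} {V : Set (ℕ → ℕ)} (hV : IsOpen V)
    (h : {x | ∀ i, x i ≤ a i} ⊆ V) : ∃ m, {x : ℕ → ℕ | ∀ i < m, x i ≤ a i} ⊆ V := by
  by_contra! hcon
  simp only [not_subset] at hcon
  choose x hx hxV using hcon
  have hK := isCompact_setOf_forall_le a
  obtain ⟨y, hy, φ, hφ, hlim⟩ := hK.tendsto_subseq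
    -- Truncation moves the points into the compact box and leaves coordinate `i` of `x m` unchanged
    -- once `m > i`, so limits agree.
    (x := fun m i => min (x m i) (a i)) fun m i => min_le_right _ _
  have hlim' : Tendsto (x ∘ φ) atTop (𝓝 y) := by
    rw [tendsto_pi_nhds] at hlim ⊢
    intro i
    refine (hlim i).congr' ?_
    filter_upwards [eventually_gt_atTop i] with m hm
    exact min_eq_left (hx (φ m) i (hm.trans_le hφ.le_apply))
  obtain ⟨m, hm⟩ := (hlim'.eventually (hV.mem_nhds (h hy))).exists
  exact hxV _ hm

/-- An analytic set all of whose compact subsets are null is null. -/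
theorem analyticSet_measure_eq_zero {X : Type*} [TopologicalSpace X] [PolishSpace X]
    [MeasurableSpace X] [BorelSpace X] {μ : Measure X} [SFinite μ] {S : Set X}
    (hS : AnalyticSet S) (h : ∀ K ⊆ S, IsCompact K → μ K = 0) : μ S = 0 := by
  -- A finite measure with the same null sets is outer regular.
  refine absolutelyContinuous_toFinite μ ?_
  replace h : ∀ K ⊆ S, IsCompact K → μ.toFinite K = 0 := fun K hKS hK =>
    toFinite_absolutelyContinuous μ (h K hKS hK)
  by_contra hne
  rw [AnalyticSet] at hS
  rcases hS with rfl | ⟨f, hf, rfl⟩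
  · exact hne measure_empty
  obtain ⟨c, hc0, hc⟩ := exists_between (pos_iff_ne_zero.2 hne)
  obtain ⟨a, ha⟩ := exists_le_forall_lt_measure_image μ.toFinite f hc
  have hK := isCompact_setOf_forall_le a
  obtain ⟨U, hKU, hU, hUc⟩ := (f '' {y : ℕ → ℕ | ∀ i, y i ≤ a i}).exists_isOpen_lt_of_lt c
    (by rw [h _ (image_subset_range _ _) (hK.image hf)]; exact hc0)
  obtain ⟨m, hm⟩ := exists_subset_of_forall_le_subset (hU.preimage hf) (image_subset_iff.1 hKU)
  exact (((ha m).trans_le (measure_mono (image_subset_iff.2 hm))).trans hUc).false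

/-! ### The digit-interleaving code -/

def blockScale (k : ℕ) : ℕ := 2 ^ (k ^ 2)

/-- Each block gains two bits: one for `z`, one spare. The spare bit keeps digits below half the
base, which prevents carries. The cost is negligible against `k ^ 2`. -/
def codeScale (k : ℕ) : ℕ := 4 ^ k * blockScale k

/-- The `k`-th digit block of `s`, consisting of `2 * k + 1` binary digits. -/
noncomputable def blockDigit (k : ℕ) (s : ℝ) : ℤ :=
  ⌊(blockScale (k + 1) : ℝ) * s⌋ - 2 ^ (2 * k + 1) * ⌊(blockScale k : ℝ) * s⌋

/-- The `k`-th digit block of `s` followed by the `k`-th bit of `z`. -/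
noncomputable def codeDigit (b : ℝ → ℕ → Bool) (k : ℕ) (s z : ℝ) : ℤ :=
  2 * blockDigit k s + (if b z k then 1 else 0)

/-- An injective encoding of `[0, 1) × ℝ` into `ℝ` for which the first coordinate is a Hölder
function of the code, with every exponent less than one. -/
noncomputable def code (b : ℝ → ℕ → Bool) (s z : ℝ) : ℝ :=
  ∑' k, (codeDigit b k s z : ℝ) / codeScale (k + 1)

theorem blockScale_pos (k : ℕ) : (0 : ℝ) < blockScale k := by
  unfold blockScale; positivity

theorem codeScale_pos (k : ℕ) : (0 : ℝ) < codeScale k := by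
  have := blockScale_pos k
  unfold codeScale; push_cast; positivity

theorem blockScale_succ (k : ℕ) : blockScale (k + 1) = 2 ^ (2 * k + 1) * blockScale k := by
  unfold blockScale
  rw [← pow_add]
  congr 1
  ring

theorem codeScale_succ (k : ℕ) : codeScale (k + 1) = 4 * 2 ^ (2 * k + 1) * codeScale k := by
  unfold codeScale
  rw [blockScale_succ]
  ring

theorem blockDigit_nonneg (k : ℕ) (s : ℝ) : 0 ≤ blockDigit k s := by
  rw [blockDigit, sub_nonneg, Int.le_floor, blockScale_succ]
  push_cast
  rw [mul_assoc]
  gcongr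
  exact Int.floor_le _

theorem blockDigit_lt (k : ℕ) (s : ℝ) : blockDigit k s < 2 ^ (2 * k + 1) := by
  rw [blockDigit, sub_lt_iff_lt_add, Int.floor_lt, blockScale_succ]
  push_cast
  have := Int.lt_floor_add_one ((blockScale k : ℝ) * s)
  have h2 : (0 : ℝ) < 2 ^ (2 * k + 1) := by positivity
  nlinarith

theorem codeDigit_nonneg (b : ℝ → ℕ → Bool) (k : ℕ) (s z : ℝ) : 0 ≤ codeDigit b k s z := by
  have := blockDigit_nonneg k s
  unfold codeDigit
  split_ifs <;> omega

theorem codeDigit_lt (b : ℝ → ℕ → Bool) (k : ℕ) (s z : ℝ) :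
    codeDigit b k s z < 2 * 2 ^ (2 * k + 1) := by
  have := blockDigit_lt k s
  unfold codeDigit
  split_ifs <;> omega

theorem codeDigit_eq_iff {b : ℝ → ℕ → Bool} {k : ℕ} {s z s' z' : ℝ} :
    codeDigit b k s z = codeDigit b k s' z' ↔
      blockDigit k s = blockDigit k s' ∧ b z k = b z' k := by
  unfold codeDigit
  cases b z k <;> cases b z' k <;> simp <;> omega

theorem floor_eq_of_blockDigit_eq {s s' : ℝ} (hs : s ∈ Ico (0 : ℝ) 1) (hs' : s' ∈ Ico (0 : ℝ) 1)
    {k : ℕ} (h : ∀ j < k, blockDigit j s = blockDigit j s') :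
    ⌊(blockScale k : ℝ) * s⌋ = ⌊(blockScale k : ℝ) * s'⌋ := by
  induction k with
  | zero =>
    have h0 : (blockScale 0 : ℝ) = 1 := by simp [blockScale]
    rw [h0, one_mul, one_mul, Int.floor_eq_zero_iff.2 hs, Int.floor_eq_zero_iff.2 hs']
  | succ k ih =>
    have h1 := ih fun j hj => h j (hj.trans k.lt_succ_self)
    have h2 := h k k.lt_succ_self
    unfold blockDigit at h2
    rw [h1] at h2
    linarith

theorem abs_sub_le_of_blockDigit_eq {s s' : ℝ} (hs : s ∈ Ico (0 : ℝ) 1)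
    (hs' : s' ∈ Ico (0 : ℝ) 1) {k : ℕ} (h : ∀ j < k, blockDigit j s = blockDigit j s') :
    |s - s'| ≤ 1 / blockScale k := by
  have h1 := Int.abs_sub_lt_one_of_floor_eq_floor (floor_eq_of_blockDigit_eq hs hs' h)
  rw [← mul_sub, abs_mul, abs_of_pos (blockScale_pos k)] at h1
  rw [le_div_iff₀ (blockScale_pos k)]
  linarith

theorem eq_of_blockDigit_eq {s s' : ℝ} (hs : s ∈ Ico (0 : ℝ) 1) (hs' : s' ∈ Ico (0 : ℝ) 1)
    (h : ∀ j, blockDigit j s = blockDigit j s') : s = s' := by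
  have hk : ∀ k : ℕ, |s - s'| ≤ (1 / 2) ^ k := by
    intro k
    refine (abs_sub_le_of_blockDigit_eq hs hs' (k := k) fun j _ => h j).trans ?_
    rw [one_div_pow, blockScale]
    push_cast
    gcongr
    · norm_num
    · nlinarith [sq_nonneg ((k : ℤ) - 1), Nat.le_self_pow (n := 2) (by norm_num) k]
  have := ge_of_tendsto' (tendsto_pow_atTop_nhds_zero_of_lt_one (r := (1 / 2 : ℝ))
    (by norm_num) (by norm_num)) hk
  exact sub_eq_zero.1 (abs_nonpos_iff.1 this)

theorem codeScale_add_le (k j : ℕ) : (codeScale k : ℝ) * 8 ^ j ≤ codeScale (k + j) := by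
  induction j with
  | zero => simp
  | succ j ih =>
    rw [← add_assoc, codeScale_succ]
    push_cast
    have : (2 : ℝ) ^ 1 ≤ 2 ^ (2 * (k + j) + 1) := by
      gcongr
      · norm_num
      · omega
    have h2 := codeScale_pos (k + j)
    rw [pow_succ]
    nlinarith

theorem abs_div_codeScale_le {k : ℕ} {e : ℝ} (he : |e| ≤ 2 * 2 ^ (2 * k + 1)) (m j : ℕ)
    (hk : k = m + j) :
    |e / codeScale (k + 1)| ≤ (1 / (2 * codeScale m)) * (1 / 8) ^ j := by
  have h1 := codeScale_add_le m j
  rw [← hk] at h1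
  rw [abs_div, abs_of_pos (codeScale_pos _), codeScale_succ, one_div_pow, one_div_mul_one_div]
  push_cast
  have h3 := codeScale_pos k
  have h4 := codeScale_pos m
  calc |e| / (4 * 2 ^ (2 * k + 1) * codeScale k)
      ≤ (2 * 2 ^ (2 * k + 1)) / (4 * 2 ^ (2 * k + 1) * codeScale k) := by gcongr
    _ = 1 / (2 * codeScale k) := by field_simp; norm_num
    _ ≤ 1 / (2 * codeScale m * 8 ^ j) := by
      gcongr 1 / ?_
      rw [mul_assoc]
      gcongr

theorem summable_code {e : ℕ → ℝ} (he : ∀ k, |e k| ≤ 2 * 2 ^ (2 * k + 1)) :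
    Summable fun k => e k / codeScale (k + 1) :=
  .of_norm_bounded ((summable_geometric_of_lt_one (by norm_num) (by norm_num)).mul_left _)
    fun k => abs_div_codeScale_le (he k) 0 k (zero_add k).symm

/-- The tail is at most `1/2 * 8/7 = 4/7` of the lower bound for the leading term, which leaves `3/7
> 1/3`. -/
theorem le_abs_tsum_div_codeScale {e : ℕ → ℝ} (he : ∀ k, |e k| ≤ 2 * 2 ^ (2 * k + 1)) {k : ℕ}
    (h0 : ∀ j < k, e j = 0) (hk : 1 ≤ |e k|) :
    1 / (3 * codeScale (k + 1)) ≤ |∑' j, e j / codeScale (j + 1)| := by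
  have hs := summable_code he
  have h1 : ∑ j ∈ Finset.range (k + 1), e j / codeScale (j + 1) = e k / codeScale (k + 1) := by
    rw [Finset.sum_range_succ, Finset.sum_eq_zero, zero_add]
    intro j hj
    rw [h0 j (Finset.mem_range.1 hj), zero_div]
  have h2 := hs.sum_add_tsum_nat_add (k + 1)
  rw [h1] at h2
  have h3 : |∑' j, e (j + (k + 1)) / codeScale (j + (k + 1) + 1)| ≤
      1 / (2 * codeScale (k + 1)) * (1 - 1 / 8)⁻¹ := by
    rw [← Real.norm_eq_abs]
    refine tsum_of_norm_bounded
      ((hasSum_geometric_of_lt_one (r := (1 / 8 : ℝ)) (by norm_num) (by norm_num)).mul_left _)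
      fun j => ?_
    exact abs_div_codeScale_le (he _) _ j (add_comm _ _)
  have h4 : 1 / (codeScale (k + 1) : ℝ) ≤ |e k / codeScale (k + 1)| := by
    rw [abs_div, abs_of_pos (codeScale_pos _)]
    have := codeScale_pos (k + 1)
    gcongr
  have h5 := abs_sub_abs_le_abs_add (e k / codeScale (k + 1))
    (∑' j, e (j + (k + 1)) / codeScale (j + (k + 1) + 1))
  rw [h2] at h5
  have h6 : 1 / (2 * (codeScale (k + 1) : ℝ)) = 1 / 2 * (1 / codeScale (k + 1)) := by
    rw [one_div_mul_one_div]
  have h7 : 1 / (3 * (codeScale (k + 1) : ℝ)) = 1 / 3 * (1 / codeScale (k + 1)) := by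
    rw [one_div_mul_one_div]
  have h8 : (0 : ℝ) < 1 / codeScale (k + 1) := one_div_pos.2 (codeScale_pos _)
  rw [h6] at h3
  have h9 : (1 - 1 / 8 : ℝ)⁻¹ = 8 / 7 := by norm_num
  rw [h9] at h3
  rw [h7]
  linarith

theorem le_abs_code_sub {b : ℝ → ℕ → Bool} {s z s' z' : ℝ} {k : ℕ}
    (h : ∀ j < k, codeDigit b j s z = codeDigit b j s' z')
    (hk : codeDigit b k s z ≠ codeDigit b k s' z') :
    1 / (3 * codeScale (k + 1)) ≤ |code b s z - code b s' z'| := by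
  have hb : ∀ (s z : ℝ) (k : ℕ), |(codeDigit b k s z : ℝ)| ≤ 2 * 2 ^ (2 * k + 1) := by
    intro s z k
    rw [abs_of_nonneg (by exact_mod_cast codeDigit_nonneg b k s z)]
    exact_mod_cast (codeDigit_lt b k s z).le
  have hsub : code b s z - code b s' z' =
      ∑' j, ((codeDigit b j s z : ℝ) - codeDigit b j s' z') / codeScale (j + 1) := by
    unfold code
    rw [← (summable_code (hb s z)).tsum_sub (summable_code (hb s' z'))]
    simp only [sub_div]
  rw [hsub]
  refine le_abs_tsum_div_codeScale (fun k => ?_) (fun j hj => ?_) ?_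
  · have h1 : (0 : ℝ) ≤ codeDigit b k s z := by exact_mod_cast codeDigit_nonneg b k s z
    have h2 : (0 : ℝ) ≤ codeDigit b k s' z' := by exact_mod_cast codeDigit_nonneg b k s' z'
    have h3 := (abs_le.1 (hb s z k)).2
    have h4 := (abs_le.1 (hb s' z' k)).2
    rw [abs_le]
    constructor <;> linarith
  · rw [h j hj, sub_self]
  · exact_mod_cast Int.one_le_abs (sub_ne_zero.2 hk)

theorem code_inj {b : ℝ → ℕ → Bool} (hb : Function.Injective b) {s z s' z' : ℝ}
    (hs : s ∈ Ico (0 : ℝ) 1) (hs' : s' ∈ Ico (0 : ℝ) 1) (h : code b s z = code b s' z') :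
    s = s' ∧ z = z' := by
  have key : ∀ k, codeDigit b k s z = codeDigit b k s' z' := by
    intro k
    induction k using Nat.strong_induction_on with
    | _ k ih =>
      by_contra hk
      have h1 := le_abs_code_sub ih hk
      rw [h, sub_self, abs_zero] at h1
      have := codeScale_pos (k + 1)
      exact absurd h1 (not_le.2 (by positivity))
  exact ⟨eq_of_blockDigit_eq hs hs' fun k => (codeDigit_eq_iff.1 (key k)).1,
    hb (funext fun k => (codeDigit_eq_iff.1 (key k)).2)⟩

theorem exists_le_mul_codeScale_rpow {r : ℝ} (hr0 : 0 < r) (hr : r < 1) :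
    ∃ C : ℝ, 0 < C ∧ ∀ k : ℕ,
      1 / (blockScale k : ℝ) ≤ C * (1 / (3 * codeScale (k + 1))) ^ r := by
  -- The exponent must dominate `(4 * k + 5) * r - (1 - r) * k ^ 2` for all `k`; completing the
  -- square gives `4 / (1 - r)`.
  refine ⟨2 ^ (5 + 4 / (1 - r)), by positivity, fun k => ?_⟩
  have h1 : (0 : ℝ) < 1 - r := by linarith
  have hc : (3 * codeScale (k + 1) : ℝ) ≤ 2 ^ ((k : ℝ) ^ 2 + 4 * k + 5) := by
    have : (2 : ℝ) ^ ((k : ℝ) ^ 2 + 4 * k + 5) = 4 * codeScale (k + 1) := by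
      unfold codeScale blockScale
      push_cast
      rw [show (k : ℝ) ^ 2 + 4 * k + 5 = ((k ^ 2 + 4 * k + 5 : ℕ) : ℝ) by push_cast; rfl,
        Real.rpow_natCast, show (4 : ℝ) = 2 ^ 2 by norm_num, ← pow_mul, ← pow_add, ← pow_add]
      congr 1
      ring
    rw [this]
    have := codeScale_pos (k + 1)
    linarith
  have hp : (0 : ℝ) < 3 * codeScale (k + 1) := by
    have := codeScale_pos (k + 1)
    linarith
  have hb : (1 : ℝ) / blockScale k = 2 ^ (-(k : ℝ) ^ 2) := by
    unfold blockScale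
    push_cast
    rw [Real.rpow_neg (by norm_num), one_div, ← Real.rpow_natCast 2 (k ^ 2)]
    push_cast
    rfl
  have h2 : (2 : ℝ) ^ (-((k : ℝ) ^ 2 + 4 * k + 5) * r) ≤ (1 / (3 * codeScale (k + 1))) ^ r := by
    rw [Real.rpow_mul (by norm_num)]
    refine Real.rpow_le_rpow (by positivity) ?_ hr0.le
    rw [Real.rpow_neg (by norm_num), ← one_div]
    gcongr
  rw [hb]
  refine le_trans ?_ (mul_le_mul_of_nonneg_left h2 (by positivity))
  rw [← Real.rpow_add (by norm_num)]
  refine Real.rpow_le_rpow_of_exponent_le (by norm_num) ?_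
  have h4 : 4 / (1 - r) * (1 - r) = 4 := div_mul_cancel₀ _ h1.ne'
  have h5 : 0 < 4 / (1 - r) := by positivity
  rw [← sub_nonneg]
  refine nonneg_of_mul_nonneg_left (b := 1 - r) ?_ h1
  have h6 : (5 + 4 / (1 - r) + -((k : ℝ) ^ 2 + 4 * k + 5) * r - -(k : ℝ) ^ 2) * (1 - r) =
      ((1 - r) * k - 2) ^ 2 + 4 * (1 - r) ^ 2 * k + 5 * (1 - r) ^ 2 := by
    linear_combination h4
  rw [h6]
  positivity

theorem exists_abs_sub_le_code_rpow (b : ℝ → ℕ → Bool) {r : ℝ} (hr0 : 0 < r) (hr : r < 1) :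
    ∃ C : ℝ, 0 < C ∧ ∀ s ∈ Ico (0 : ℝ) 1, ∀ s' ∈ Ico (0 : ℝ) 1, ∀ z z' : ℝ,
      |s - s'| ≤ C * |code b s z - code b s' z'| ^ r := by
  obtain ⟨C, hC, h⟩ := exists_le_mul_codeScale_rpow hr0 hr
  refine ⟨C, hC, fun s hs s' hs' z z' => ?_⟩
  by_cases hss : s = s'
  · rw [hss, sub_self, abs_zero]
    positivity
  have hex : ∃ k, codeDigit b k s z ≠ codeDigit b k s' z' := by
    by_contra! hcon
    exact hss (eq_of_blockDigit_eq hs hs' fun k => (codeDigit_eq_iff.1 (hcon k)).1)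
  classical
  have hlt : ∀ j < Nat.find hex, codeDigit b j s z = codeDigit b j s' z' := fun j hj =>
    not_not.1 (Nat.find_min hex hj)
  refine (abs_sub_le_of_blockDigit_eq hs hs' fun j hj => (codeDigit_eq_iff.1 (hlt j hj)).1).trans
    ((h _).trans ?_)
  have := codeScale_pos (Nat.find hex + 1)
  gcongr
  exact le_abs_code_sub hlt (Nat.find_spec hex)

theorem measurable_blockDigit (k : ℕ) : Measurable (blockDigit k) := by
  have h3 : ∀ c : ℝ, Measurable fun s : ℝ => ⌊c * s⌋ := fun c =>
    Int.measurable_floor.comp (measurable_id.const_mul c)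
  exact (h3 (blockScale (k + 1))).sub ((h3 (blockScale k)).const_mul (2 ^ (2 * k + 1)))

theorem measurable_code {b : ℝ → ℕ → Bool} (hb : Measurable b) :
    Measurable fun p : ℝ × ℝ => code b p.1 p.2 := by
  have hd : ∀ k, Measurable fun p : ℝ × ℝ => (codeDigit b k p.1 p.2 : ℝ) := by
    intro k
    have h1 : MeasurableSet {p : ℝ × ℝ | b p.2 k = true} :=
      ((measurable_pi_apply k).comp (hb.comp measurable_snd)) (measurableSet_singleton true)
    have h2 : Measurable fun p : ℝ × ℝ => (if b p.2 k = true then (1 : ℤ) else 0) :=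
      Measurable.ite h1 measurable_const measurable_const
    have h3 : Measurable fun p : ℝ × ℝ => 2 * blockDigit k p.1 :=
      ((measurable_blockDigit k).comp measurable_fst).const_mul 2
    exact (measurable_from_top (f := fun m : ℤ => (m : ℝ))).comp (h3.add h2)
  have hs : ∀ p : ℝ × ℝ, Summable fun k => (codeDigit b k p.1 p.2 : ℝ) / codeScale (k + 1) := by
    intro p
    refine summable_code fun k => ?_
    rw [abs_of_nonneg (by exact_mod_cast codeDigit_nonneg b k p.1 p.2)]
    exact_mod_cast (codeDigit_lt b k p.1 p.2).le
  have hsum : ∀ n, Measurable fun p : ℝ × ℝ =>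
      ∑ k ∈ Finset.range n, (codeDigit b k p.1 p.2 : ℝ) / codeScale (k + 1) := fun n =>
    Finset.measurable_fun_sum _ fun k _ => (hd k).div_const _
  exact measurable_of_tendsto_metrizable hsum
    (tendsto_pi_nhds.2 fun p => (hs p).hasSum.tendsto_sum_nat)

/-! ### Generic affine choice of the hidden coordinate -/

theorem volume_eq_zero_of_countable_slices {T : Set (ℝ × ℝ)} (hT : MeasurableSet T) (c : ℝ)
    (h : ∀ p : ℝ, {v : ℝ | (v, p - v * c) ∈ T}.Countable) : volume T = 0 := by
  have hg : Measurable (Function.uncurry fun v p : ℝ => p - v * c) := by fun_prop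
  -- A shear straightens the lines `u + v * c = p` and preserves area.
  have hmp := (MeasurePreserving.id (volume : Measure ℝ)).skew_product (μc := volume)
    (μd := volume) hg (ae_of_all _ fun v => (measurePreserving_sub_right volume (v * c)).map_eq)
  rw [Measure.volume_eq_prod, ← hmp.measure_preimage hT.nullMeasurableSet,
    Measure.prod_apply_symm (hmp.measurable hT)]
  exact lintegral_eq_zero_of_ae_eq_zero (ae_of_all _ fun p => (h p).measure_zero _)

/-- Along each line `u + v * θ w = p` the parameters for which a given `w` is bad form a countable
set, so for almost all affine functions of `θ` almost every point of the graph is good. -/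
theorem exists_ae_forall_not_rel {X Y : Type*} [MeasurableSpace X]
    [TopologicalSpace Y] [PolishSpace Y] [MeasurableSpace Y] [BorelSpace Y] {μ : Measure Y}
    [SFinite μ] {Q : X → X → Prop} (hcount : ∀ y, {x | Q x y}.Countable)
    (hQ : MeasurableSet {p : X × X | Q p.1 p.2}) {D : Set Y} (hD : MeasurableSet D)
    {Ψ : Y → ℝ → X} (hΨ : Measurable fun p : Y × ℝ => Ψ p.1 p.2)
    (hinj : ∀ w ∈ D, ∀ w' ∈ D, ∀ z z', Ψ w z = Ψ w' z' → w = w' ∧ z = z')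
    {θ : Y → ℝ} (hθ : Measurable θ) (hθi : Function.Injective θ) :
    ∃ v u : ℝ, ∀ᵐ w' ∂μ, w' ∈ D → ∀ w ∈ D, w ≠ w' →
      ¬ Q (Ψ w (u + v * θ w)) (Ψ w' (u + v * θ w')) := by
  let B : Set (((ℝ × ℝ) × Y) × Y) := {q | (q.1.2 ∈ D ∧ q.2 ∈ D ∧ q.2 ≠ q.1.2) ∧
    Q (Ψ q.2 (q.1.1.2 + q.1.1.1 * θ q.2)) (Ψ q.1.2 (q.1.1.2 + q.1.1.1 * θ q.1.2))}
  have hB : MeasurableSet B := by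
    refine MeasurableSet.inter ?_ ?_
    · have h1 : Measurable fun q : ((ℝ × ℝ) × Y) × Y => q.1.2 := by fun_prop
      exact (h1 hD).inter ((measurable_snd hD).inter
        (measurableSet_eq_fun measurable_snd h1).compl)
    · have h1 : Measurable fun q : ((ℝ × ℝ) × Y) × Y => (q.2, q.1.1.2 + q.1.1.1 * θ q.2) := by
        fun_prop
      have h2 : Measurable fun q : ((ℝ × ℝ) × Y) × Y =>
          (q.1.2, q.1.1.2 + q.1.1.1 * θ q.1.2) := by
        fun_prop
      exact ((hΨ.comp h1).prodMk (hΨ.comp h2)) hQ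
  have hS : AnalyticSet (Prod.fst '' B) := hB.analyticSet.image_of_continuous continuous_fst
  have hnull : ((volume : Measure (ℝ × ℝ)).prod μ) (Prod.fst '' B) = 0 := by
    -- The bad set is only a projection of a Borel set; Fubini is applied to its compact subsets.
    refine analyticSet_measure_eq_zero hS fun K hK hKc => ?_
    rw [Measure.prod_apply_symm hKc.measurableSet]
    refine lintegral_eq_zero_of_ae_eq_zero (ae_of_all _ fun w' => ?_)
    refine volume_eq_zero_of_countable_slices
      (measurable_prodMk_right hKc.measurableSet) (θ w') fun p => ?_
    refine ((hcount (Ψ w' p)).biUnion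
      (t := fun x _ => {v : ℝ | w' ∈ D ∧ ∃ w ∈ D, w ≠ w' ∧ Ψ w (p - v * θ w' + v * θ w) = x})
      fun x _ => Set.Subsingleton.countable ?_).mono ?_
    · rintro v₁ ⟨-, w₁, hw₁, hne, h₁⟩ v₂ ⟨-, w₂, hw₂, -, h₂⟩
      obtain ⟨rfl, h⟩ := hinj _ hw₁ _ hw₂ _ _ (h₁.trans h₂.symm)
      have h0 : (v₁ - v₂) * (θ w₁ - θ w') = 0 := by linear_combination h
      rcases mul_eq_zero.1 h0 with h0 | h0
      · exact sub_eq_zero.1 h0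
      · exact absurd (hθi (sub_eq_zero.1 h0)) hne
    · intro v hv
      obtain ⟨⟨r, w⟩, ⟨⟨hw', hw, hne⟩, hq⟩, rfl : r = _⟩ := hK hv
      simp only [sub_add_cancel] at hq
      exact mem_biUnion hq ⟨hw', w, hw, hne, rfl⟩
  have hae := Measure.ae_ae_of_ae_prod (measure_eq_zero_iff_ae_notMem.1 hnull)
  obtain ⟨⟨v, u⟩, hr⟩ := hae.exists
  refine ⟨v, u, ?_⟩
  filter_upwards [hr] with w' hw' hw'D w hw hne hq
  exact hw' ⟨(((v, u), w'), w), ⟨⟨hw'D, hw, hne⟩, hq⟩, rfl⟩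

theorem exists_isCompact_antichain {X Y : Type*} [TopologicalSpace X] [PolishSpace X]
    [MeasurableSpace X] [BorelSpace X]
    [TopologicalSpace Y] [PolishSpace Y] [MeasurableSpace Y] [BorelSpace Y] {μ : Measure Y}
    [IsFiniteMeasure μ] {Q : X → X → Prop} (hcount : ∀ y, {x | Q x y}.Countable)
    (hQ : MeasurableSet {p : X × X | Q p.1 p.2}) {D : Set Y} (hD : MeasurableSet D)
    (hμD : μ D ≠ 0)
    {Ψ : Y → ℝ → X} (hΨ : Measurable fun p : Y × ℝ => Ψ p.1 p.2)
    (hinj : ∀ w ∈ D, ∀ w' ∈ D, ∀ z z', Ψ w z = Ψ w' z' → w = w' ∧ z = z') :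
    ∃ (A : Set X) (ζ : Y → ℝ), IsCompact A ∧ IsAntichain Q A ∧
      μ {w ∈ D | Ψ w (ζ w) ∈ A} ≠ 0 := by
  have hθ := measurableEmbedding_embeddingReal Y
  obtain ⟨v, u, h⟩ := exists_ae_forall_not_rel (μ := μ) hcount hQ hD hΨ hinj hθ.measurable
    hθ.injective
  set ζ : Y → ℝ := fun w => u + v * embeddingReal Y w with hζ
  have hζm : Measurable ζ := (hθ.measurable.const_mul v).const_add u
  let Φ : Y → X := fun w => Ψ w (ζ w)
  have hΦ : Measurable Φ := hΨ.comp (measurable_id.prodMk hζm)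
  have hΦi : InjOn Φ D := fun w hw w' hw' h => (hinj w hw w' hw' _ _ h).1
  obtain ⟨N, hN, hNm, hN0⟩ := exists_measurable_superset_of_null (ae_iff.1 h)
  have hG : MeasurableSet (D \ N) := hD.diff hNm
  have hGi : InjOn Φ (D \ N) := hΦi.mono sdiff_subset
  -- Lusin–Souslin: injectivity makes the image Borel, so the pushforward measure can be
  -- approximated from inside by compact sets.
  have himg : MeasurableSet (Φ '' (D \ N)) := hG.image_of_measurable_injOn hΦ hGi
  have hpos : 0 < (μ.restrict D).map Φ (Φ '' (D \ N)) := by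
    rw [Measure.map_apply hΦ himg, Measure.restrict_apply (hΦ himg), pos_iff_ne_zero]
    refine fun h0 => hμD ?_
    rw [← measure_sdiff_null hN0]
    have hsub : D \ N ⊆ Φ ⁻¹' (Φ '' (D \ N)) ∩ D := fun w hw => ⟨mem_image_of_mem Φ hw, hw.1⟩
    exact measure_mono_null hsub h0
  obtain ⟨A, hAs, hA, hA0⟩ := himg.exists_lt_isCompact hpos
  refine ⟨A, ζ, hA, ?_, ?_⟩
  · intro x hx y hy hxy hq
    obtain ⟨w, hw, rfl⟩ := hAs hx
    obtain ⟨w', hw', rfl⟩ := hAs hy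
    have hgood := not_not.1 fun hbad => hw'.2 (hN hbad)
    exact hgood hw'.1 w hw.1 (fun h => hxy (h ▸ rfl)) hq
  · rw [Measure.map_apply hΦ hA.measurableSet, Measure.restrict_apply (hΦ hA.measurableSet)] at hA0
    refine (hA0.trans_le (measure_mono ?_)).ne'
    exact fun w hw => ⟨hw.2, hw.1⟩

/-! ### Hausdorff dimension and conclusion -/

theorem le_dimH_of_volume_ne_zero {n : ℕ} {V : Set (Fin n → ℝ)} (hV : volume V ≠ 0) :
    (n : ENNReal) ≤ dimH V := by
  rw [← hausdorffMeasure_pi_real] at hV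
  have := le_dimH_of_hausdorffMeasure_ne_zero (d := (n : NNReal)) (s := V) (by simpa using hV)
  simpa using this

noncomputable def vectorCode {n : ℕ} (b : ℝ → ℕ → Bool) (w : Fin n → ℝ) (z : ℝ) :
    EuclideanSpace ℝ (Fin n) :=
  WithLp.toLp 2 fun i => code b (w i) z

theorem measurable_vectorCode {n : ℕ} {b : ℝ → ℕ → Bool} (hb : Measurable b) :
    Measurable fun p : (Fin n → ℝ) × ℝ => vectorCode b p.1 p.2 := by
  have hp : ∀ i, Measurable fun p : (Fin n → ℝ) × ℝ => (p.1 i, p.2) := fun i =>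
    ((measurable_pi_apply i).comp measurable_fst).prodMk measurable_snd
  have hc : ∀ i, Measurable fun p : (Fin n → ℝ) × ℝ => code b (p.1 i) p.2 := fun i => by
    simpa only [Function.comp_def] using (measurable_code hb).comp (hp i)
  exact (WithLp.measurable_toLp 2 _).comp (measurable_pi_iff.2 hc)

theorem vectorCode_inj {n : ℕ} (hn : n ≠ 0) {b : ℝ → ℕ → Bool} (hb : Function.Injective b)
    {w w' : Fin n → ℝ} (hw : ∀ i, w i ∈ Ico (0 : ℝ) 1) (hw' : ∀ i, w' i ∈ Ico (0 : ℝ) 1)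
    {z z' : ℝ} (h : vectorCode b w z = vectorCode b w' z') : w = w' ∧ z = z' := by
  have key : ∀ i, w i = w' i ∧ z = z' := fun i =>
    code_inj hb (hw i) (hw' i) (congrFun (congrArg WithLp.ofLp h) i)
  exact ⟨funext fun i => (key i).1, (key ⟨0, Nat.pos_of_ne_zero hn⟩).2⟩

theorem exists_dist_le_vectorCode_rpow {n : ℕ} (b : ℝ → ℕ → Bool) {r : ℝ} (hr0 : 0 < r)
    (hr : r < 1) : ∃ C : ℝ, 0 < C ∧ ∀ w w' : Fin n → ℝ, (∀ i, w i ∈ Ico (0 : ℝ) 1) →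
      (∀ i, w' i ∈ Ico (0 : ℝ) 1) → ∀ z z' : ℝ,
      dist w w' ≤ C * dist (vectorCode b w z) (vectorCode b w' z') ^ r := by
  obtain ⟨C, hC, h⟩ := exists_abs_sub_le_code_rpow b hr0 hr
  refine ⟨C, hC, fun w w' hw hw' z z' => (dist_pi_le_iff (by positivity)).2 fun i => ?_⟩
  rw [Real.dist_eq]
  refine (h _ (hw i) _ (hw' i) z z').trans ?_
  gcongr
  have := PiLp.norm_apply_le (vectorCode b w z - vectorCode b w' z') i
  rwa [← dist_eq_norm] at this

/-- Decoding is `r`-Hölder, so it multiplies dimension by at most `1 / r`; its image has positive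
volume. Then `r` tends to 1. No regularity of `ζ` is needed. -/
theorem le_dimH_of_volume_vectorCode_ne_zero {n : ℕ} {b : ℝ → ℕ → Bool} {ζ : (Fin n → ℝ) → ℝ}
    {A : Set (EuclideanSpace ℝ (Fin n))}
    (hA : volume {w ∈ univ.pi fun _ : Fin n => Ico (0 : ℝ) 1 | vectorCode b w (ζ w) ∈ A} ≠ 0) :
    (n : ENNReal) ≤ dimH A := by
  set V := {w ∈ univ.pi fun _ : Fin n => Ico (0 : ℝ) 1 | vectorCode b w (ζ w) ∈ A} with hV
  let Φ : (Fin n → ℝ) → EuclideanSpace ℝ (Fin n) := fun w => vectorCode b w (ζ w)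
  have key : ∀ r : NNReal, r < 1 → (r : ENNReal) * n ≤ dimH A := by
    intro r hr
    rcases eq_or_ne r 0 with rfl | hr0
    · simp
    have hr0 : 0 < r := pos_iff_ne_zero.2 hr0
    obtain ⟨C, hC, h⟩ := exists_dist_le_vectorCode_rpow (n := n) b (r := r)
      (by exact_mod_cast hr0) (by exact_mod_cast hr)
    have hbound : ∀ w ∈ V, ∀ w' ∈ V, dist w w' ≤ C * dist (Φ w) (Φ w') ^ (r : ℝ) :=
      fun w hw w' hw' => h w w' (fun i => hw.1 i trivial) (fun i => hw'.1 i trivial) _ _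
    have hinj : InjOn Φ V := by
      intro w hw w' hw' he
      have := hbound w hw w' hw'
      rw [he, dist_self, Real.zero_rpow (by exact_mod_cast hr0.ne'), mul_zero] at this
      exact dist_le_zero.1 this
    have hh : HolderOnWith C.toNNReal r (Function.invFunOn Φ V) (Φ '' V) := by
      rintro _ ⟨w, hw, rfl⟩ _ ⟨w', hw', rfl⟩
      rw [hinj.leftInvOn_invFunOn hw, hinj.leftInvOn_invFunOn hw', edist_dist, edist_dist,
        ENNReal.ofReal_rpow_of_nonneg dist_nonneg r.coe_nonneg]
      change _ ≤ ENNReal.ofReal C * _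
      rw [← ENNReal.ofReal_mul hC.le]
      exact ENNReal.ofReal_le_ofReal (hbound w hw w' hw')
    have h1 := hh.dimH_image_le hr0
    rw [hinj.leftInvOn_invFunOn.image_image] at h1
    have h2 : dimH (Φ '' V) ≤ dimH A := dimH_mono (image_subset_iff.2 fun w hw => hw.2)
    have h3 := (le_dimH_of_volume_ne_zero hA).trans h1
    rw [ENNReal.le_div_iff_mul_le (Or.inl (by exact_mod_cast hr0.ne'))
      (Or.inl ENNReal.coe_ne_top), mul_comm] at h3
    exact h3.trans h2
  refine le_of_forall_lt fun a ha => ?_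
  have hlim : Tendsto (fun r : NNReal => (r : ENNReal) * n) (𝓝[<] 1)
      (𝓝 (((1 : NNReal) : ENNReal) * n)) :=
    (ENNReal.Tendsto.mul_const (ENNReal.tendsto_coe.2 tendsto_id) (Or.inl one_ne_zero)).mono_left
      nhdsWithin_le_nhds
  rw [ENNReal.coe_one, one_mul] at hlim
  have hne : (𝓝[<] (1 : NNReal)).NeBot := nhdsLT_neBot_of_exists_lt ⟨0, one_pos⟩
  have := (hlim.eventually (lt_mem_nhds ha)).and self_mem_nhdsWithin
  obtain ⟨r, hr1, hr2⟩ := this.exists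
  exact hr1.trans_le (key r hr2)

theorem mainTheorem6 (n : ℕ)
    (Q : EuclideanSpace ℝ (Fin n) → EuclideanSpace ℝ (Fin n) → Prop)
    (hrefl : ∀ x, Q x x)
    (htrans : ∀ x y z, Q x y → Q y z → Q x z)
    (hcount : ∀ y, {x | Q x y}.Countable)
    (hborel : MeasurableSet
      {p : EuclideanSpace ℝ (Fin n) × EuclideanSpace ℝ (Fin n) | Q p.1 p.2}) :
    ∃ A : Set (EuclideanSpace ℝ (Fin n)), IsClosed A ∧ IsAntichain Q A ∧ dimH A = n := by
  rcases eq_or_ne n 0 with rfl | hn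
  -- With no coordinates the code cannot carry `z`.
  · exact ⟨{0}, isClosed_singleton, IsAntichain.singleton, by simp⟩
  obtain ⟨b, hb, hbi⟩ := MeasurableSpace.measurable_injection_nat_bool_of_countablySeparated ℝ
  let D : Set (Fin n → ℝ) := univ.pi fun _ => Ico 0 1
  have hD : MeasurableSet D := MeasurableSet.univ_pi fun _ => measurableSet_Ico
  have hvol : volume D = 1 := by simp [D, Real.volume_pi_Ico]
  have : IsFiniteMeasure (volume.restrict D) := ⟨by simp [hvol]⟩
  obtain ⟨A, ζ, hA, hanti, hpos⟩ := exists_isCompact_antichain (μ := volume.restrict D) hcount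
    hborel hD (by simp [hvol]) (measurable_vectorCode hb) fun w hw w' hw' z z' =>
      vectorCode_inj hn hbi (fun i => hw i trivial) fun i => hw' i trivial
  refine ⟨A, hA.isClosed, hanti, le_antisymm ?_ ?_⟩
  · refine (dimH_mono (subset_univ A)).trans ?_
    rw [Real.dimH_univ_eq_finrank, finrank_euclideanSpace_fin]
  · exact le_dimH_of_volume_vectorCode_ne_zero (b := b) (ζ := ζ)
      fun h0 => hpos (Measure.absolutelyContinuous_of_le Measure.restrict_le_self h0)
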